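/- For an integer $n\ge 2$ let $$\mathcal X_n=\left\{\left\lfloor \frac{2n}{\log n}\,\log p\right\rfloor \;:\; p \text{ prime},\ p\le \sqrt{\frac{n}{2\log n}}\right\}\subset\mathbb N .$$ For all sufficiently large $n$, the finite set $\mathcal X_n$ is a Sidon set, that is, whenever $a,b,c,d\in\mathcal X_n$ (not necessarily distinct) satisfy $a+b=c+d$, then $\{a,b\}=\{c,d\}$. Moreover, as $n\to\infty$, $$|\mathcal X_n|\sim \frac{\sqrt{2n}}{(\log n)^{3/2}} .$$ -/

import Mathlib

open Filter Asymptotics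

/-- A set is a Sidon set if the sums `a + b` of two of its elements (possibly equal) are distinct,
up to the order of the summands. -/
def IsSidon {α : Type*} [AddCommMonoid α] (S : Set α) : Prop :=
  ∀ a ∈ S, ∀ b ∈ S, ∀ c ∈ S, ∀ d ∈ S, a + b = c + d → (a = c ∧ b = d) ∨ (a = d ∧ b = c)

/-- The set of the natural numbers `[(2n / log n) log p]`, where `p` runs over the primes
with `p ≤ √(n / (2 log n))`. The argument of the floor is never negative, so that the
natural-number floor is the usual integer part. -/
noncomputable def logPrimeSet (n : ℕ) : Set ℕ :=
  {x | ∃ p : ℕ, p.Prime ∧ (p : ℝ) ≤ √((n : ℝ) / (2 * Real.log n)) ∧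
    x = ⌊2 * (n : ℝ) / Real.log n * Real.log p⌋₊}

/-! Sidon property: if `a * b < c * d` are products of integers at most `√(n / (2 log n))`, then
`log (c * d) - log (a * b) ≥ 1 / (c * d) ≥ 2 log n / n`. Scaling by `2n / log n` turns this into a
gap of at least 4, while rounding down costs the larger side less than 2. So equal sums of floors
force equal products (`mul_eq_mul_of_floor_log_add_floor_log_eq`), and unique factorization recovers
the pair of primes.

Cardinality: the same argument shows that distinct primes give distinct floors, so the size is
`π(√(n / (2 log n)))`, and the prime number theorem gives the asymptotics.

The prime number theorem is proved in Wiener–Ikehara style for `ψ(e^u) e^(-u)`, which is bounded by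
Chebyshev's estimate. Subtracting the main term leaves an error whose Laplace transform extends
continuously to the closed right half-plane, so its averages against a band-limited kernel vanish at
infinity by Riemann–Lebesgue (`tendsto_integral_fourier_mul_atTop_zero`). Monotonicity of `ψ` then
turns convergence of averages into pointwise convergence (`tendsto_one_of_slowlyDecreasing`). -/

/-! ### Averages of a function whose Laplace transform extends to the boundary -/

section FourierTauberian

open MeasureTheory Topology FourierTransform Set

/-- Modulating a function translates its Fourier transform. -/
theorem Real.fourier_fourierChar_mul (k : ℝ → ℂ) (y u : ℝ) :
    𝓕 (fun v : ℝ ↦ (𝐞 (y * v) : ℂ) * k v) u = 𝓕 k (u - y) := by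
  rw [Real.fourier_real_eq, Real.fourier_real_eq]
  refine integral_congr_ae (Eventually.of_forall fun v ↦ ?_)
  simp only [Circle.smul_def, smul_eq_mul]
  rw [← mul_assoc, ← Circle.coe_mul, ← AddChar.map_add_eq_mul]
  ring_nf

theorem Real.integral_fourier_mul_eq_flip {f g : ℝ → ℂ} (hf : Integrable f) (hg : Integrable g) :
    ∫ x, 𝓕 f x * g x = ∫ x, f x * 𝓕 g x := by
  simpa using! (VectorFourier.integral_fourierIntegral_smul_eq_flip (L := innerₗ ℝ)
    Real.continuous_fourierChar continuous_inner hf hg)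

/-- The integral of a bounded function supported on the positive half-line against the translates
of the Fourier transform of a compactly supported function tends to zero, if the Laplace transform
of the bounded function extends continuously to the closed right half-plane. -/
theorem tendsto_integral_fourier_mul_atTop_zero {h : ℝ → ℂ} {C : ℝ} (hm : Measurable h)
    (hC : ∀ u, ‖h u‖ ≤ C) (h0 : ∀ u ≤ 0, h u = 0) {G : ℂ → ℂ}
    (hG : ContinuousOn G {s | 0 ≤ s.re})
    (hL : ∀ σ : ℝ, 0 < σ → ∀ v : ℝ,
      𝓕 (fun u : ℝ ↦ (Real.exp (-σ * u) : ℂ) * h u) v = G (σ + 2 * Real.pi * v * Complex.I))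
    {k : ℝ → ℂ} (hk : Continuous k) (hks : HasCompactSupport k) (hki : Integrable (𝓕 k)) :
    Tendsto (fun y : ℝ ↦ ∫ u, 𝓕 k (u - y) * h u) atTop (𝓝 0) := by
  have hC0 : 0 ≤ C := (norm_nonneg _).trans (hC 0)
  have hkI : Integrable k := hk.integrable_of_hasCompactSupport hks
  have hint : ∀ σ : ℝ, 0 < σ → Integrable (fun u : ℝ ↦ (Real.exp (-σ * u) : ℂ) * h u) := by
    intro σ hσ
    have h1 : Integrable (fun u : ℝ ↦ (Ioi (0 : ℝ)).indicator
        (fun u ↦ C * Real.exp (-σ * u)) u) := by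
      rw [integrable_indicator_iff measurableSet_Ioi]
      exact (integrableOn_exp_mul_Ioi (by linarith : -σ < 0) 0).const_mul C
    refine h1.mono' ?_ (Eventually.of_forall fun u ↦ ?_)
    · exact Measurable.aestronglyMeasurable (by fun_prop)
    · rcases le_or_gt u 0 with hu | hu
      · simp [h0 u hu, not_lt.mpr hu]
      · rw [indicator_of_mem (by exact hu), norm_mul, Complex.norm_real, Real.norm_eq_abs,
          Real.abs_exp, mul_comm]
        gcongr
        exact hC u
  have hky : ∀ y : ℝ, Integrable (fun v : ℝ ↦ (𝐞 (y * v) : ℂ) * k v) := by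
    intro y
    refine hkI.norm.mono' ?_ (Eventually.of_forall fun v ↦ by
      rw [norm_mul, Circle.norm_coe, one_mul])
    exact Continuous.aestronglyMeasurable (by fun_prop)
  -- For `σ > 0` the damped identity is the multiplication formula for the Fourier transform;
  -- dominated convergence lets `σ → 0⁺` on both sides.
  have hkey : ∀ y : ℝ, ∫ u, 𝓕 k (u - y) * h u =
      ∫ v, (𝐞 (y * v) : ℂ) * k v * G (2 * Real.pi * v * Complex.I) := by
    intro y
    have e1 : Tendsto (fun σ : ℝ ↦ ∫ u, 𝓕 k (u - y) * ((Real.exp (-σ * u) : ℂ) * h u))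
        (𝓝[>] 0) (𝓝 (∫ u, 𝓕 k (u - y) * h u)) := by
      have hkc : Integrable (fun u ↦ 𝓕 k (u - y)) := hki.comp_sub_right y
      refine tendsto_integral_filter_of_dominated_convergence
        (fun u ↦ ‖𝓕 k (u - y)‖ * C) ?_ ?_ (hkc.norm.mul_const C) ?_
      · refine Eventually.of_forall fun σ ↦ hkc.aestronglyMeasurable.mul ?_
        exact Measurable.aestronglyMeasurable (by fun_prop)
      · filter_upwards [self_mem_nhdsWithin] with σ hσ
        refine Eventually.of_forall fun u ↦ ?_
        rw [norm_mul]
        gcongr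
        rcases le_or_gt u 0 with hu | hu
        · simpa [h0 u hu] using hC0
        · rw [norm_mul, Complex.norm_real, Real.norm_eq_abs, Real.abs_exp]
          have : Real.exp (-σ * u) ≤ 1 := by
            rw [Real.exp_le_one_iff]
            nlinarith [mul_pos (show (0 : ℝ) < σ from hσ) hu]
          calc _ ≤ 1 * C := by gcongr; exact hC u
            _ = C := one_mul C
      · refine Eventually.of_forall fun u ↦ ?_
        have : Continuous fun σ : ℝ ↦ 𝓕 k (u - y) * ((Real.exp (-σ * u) : ℂ) * h u) := by fun_prop
        simpa using (this.tendsto 0).mono_left nhdsWithin_le_nhds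
    have e2 : Tendsto (fun σ : ℝ ↦ ∫ v, (𝐞 (y * v) : ℂ) * k v *
        G (σ + 2 * Real.pi * v * Complex.I)) (𝓝[>] 0)
        (𝓝 (∫ v, (𝐞 (y * v) : ℂ) * k v * G (2 * Real.pi * v * Complex.I))) := by
      -- Compact support of `k` confines the relevant arguments of `G` to a compact set, which
      -- supplies the dominating constant.
      have hGc : ContinuousOn (fun p : ℝ × ℝ ↦ G (p.1 + 2 * Real.pi * p.2 * Complex.I))
          (Icc 0 1 ×ˢ tsupport k) := by
        refine hG.comp (by fun_prop) fun p hp ↦ ?_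
        simpa using hp.1.1
      obtain ⟨M, hM⟩ := (isCompact_Icc.prod hks).exists_bound_of_continuousOn hGc
      refine tendsto_integral_filter_of_dominated_convergence
        (fun v ↦ ‖k v‖ * M) ?_ ?_ (hkI.norm.mul_const M) ?_
      · filter_upwards [self_mem_nhdsWithin] with σ hσ
        refine (hky y).aestronglyMeasurable.mul (Continuous.aestronglyMeasurable ?_)
        refine hG.comp_continuous (by fun_prop) fun v ↦ ?_
        simpa using le_of_lt hσ
      · filter_upwards [Ioc_mem_nhdsGT (show (0 : ℝ) < 1 by norm_num)] with σ hσ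
        refine Eventually.of_forall fun v ↦ ?_
        rw [norm_mul, norm_mul, Circle.norm_coe, one_mul]
        by_cases hv : v ∈ tsupport k
        · gcongr
          exact hM (σ, v) ⟨⟨hσ.1.le, hσ.2⟩, hv⟩
        · simp [image_eq_zero_of_notMem_tsupport hv]
      · refine Eventually.of_forall fun v ↦ ?_
        refine Tendsto.const_mul _ ?_
        have h1 : ContinuousWithinAt G {s | 0 ≤ s.re} (2 * Real.pi * v * Complex.I) :=
          hG _ (by simp)
        refine h1.tendsto.comp (tendsto_nhdsWithin_iff.mpr ⟨?_, ?_⟩)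
        · have : Continuous fun σ : ℝ ↦ (σ : ℂ) + 2 * Real.pi * v * Complex.I := by fun_prop
          simpa using (this.tendsto 0).mono_left nhdsWithin_le_nhds
        · filter_upwards [self_mem_nhdsWithin] with σ hσ
          simpa using le_of_lt hσ
    refine tendsto_nhds_unique e1 (e2.congr' ?_)
    filter_upwards [self_mem_nhdsWithin] with σ hσ
    have := Real.integral_fourier_mul_eq_flip (hky y) (hint σ hσ)
    simp_rw [Real.fourier_fourierChar_mul, hL σ hσ] at this
    exact this.symm
  simp_rw [hkey]
  -- Riemann–Lebesgue at frequency `-y`.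
  have hRL := (Real.tendsto_integral_exp_smul_cocompact
    (fun v : ℝ ↦ k v * G (2 * Real.pi * v * Complex.I))).comp
      (tendsto_neg_atTop_atBot.mono_right atBot_le_cocompact)
  refine hRL.congr fun y ↦ integral_congr_ae (Eventually.of_forall fun v ↦ ?_)
  simp only [Circle.smul_def, smul_eq_mul, mul_assoc]
  congr 3
  ring_nf

end FourierTauberian

/-! ### A nonnegative band-limited kernel -/

section FourierKernel

open MeasureTheory Topology FourierTransform Set

theorem Real.fourier_comp_div (k : ℝ → ℂ) {l : ℝ} (hl : 0 < l) (u : ℝ) :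
    𝓕 (fun v ↦ k (v / l)) u = l * 𝓕 k (l * u) := by
  rw [Real.fourier_real_eq, Real.fourier_real_eq]
  have := Measure.integral_comp_div (fun v : ℝ ↦ 𝐞 (-(v * (l * u))) • k v) l
  rw [abs_of_pos hl, Complex.real_smul] at this
  rw [← this]
  refine integral_congr_ae (Eventually.of_forall fun v ↦ ?_)
  simp only
  congr 3
  field_simp

/-- The Fourier transform of a real-valued even function is real-valued. -/
theorem Real.conj_fourier_of_even {g : ℝ → ℝ} (hg : ∀ x, g (-x) = g x) (u : ℝ) :
    (starRingEnd ℂ) (𝓕 (fun x ↦ (g x : ℂ)) u) = 𝓕 (fun x ↦ (g x : ℂ)) u := by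
  rw [Real.fourier_real_eq, ← integral_conj, ← integral_neg_eq_self]
  refine integral_congr_ae (Eventually.of_forall fun v ↦ ?_)
  simp only [Circle.smul_def, smul_eq_mul, map_mul, Complex.conj_ofReal, hg]
  rw [← Circle.coe_inv_eq_conj, ← AddChar.map_neg_eq_inv]
  ring_nf

/-- There is a probability density that is the Fourier transform of a continuous, compactly
supported function. -/
theorem exists_fourier_eq_density : ∃ (k : ℝ → ℂ) (K : ℝ → ℝ), Continuous k ∧
    HasCompactSupport k ∧ (∀ u, 𝓕 k u = K u) ∧ Integrable K ∧ (∀ u, 0 ≤ K u) ∧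
    ∫ u, K u = 1 := by
  let b : ContDiffBump (0 : ℝ) := ⟨1, 2, by norm_num, by norm_num⟩
  let g : ℝ → ℂ := fun x ↦ (b x : ℂ)
  have hgs : HasCompactSupport g := b.hasCompactSupport.comp_left (g := fun x : ℝ ↦ (x : ℂ)) rfl
  have hgd : ContDiff ℝ (⊤ : ℕ∞) g := Complex.ofRealCLM.contDiff.comp b.contDiff
  let φ : SchwartzMap ℝ ℂ := hgs.toSchwartzMap hgd
  have hgI : Integrable g := φ.integrable
  have hFI : Integrable (𝓕 g) := by
    have := (𝓕 φ).integrable (μ := volume)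
    rwa [SchwartzMap.fourier_coe] at this
  have hFc : Continuous (𝓕 g) := by
    have := (𝓕 φ).continuous
    rwa [SchwartzMap.fourier_coe] at this
  have hFb : ∀ u, ‖𝓕 g u‖ ≤ ∫ x, ‖g x‖ := fun u ↦
    VectorFourier.norm_fourierIntegral_le_integral_norm _ _ _ _ _
  have hre : ∀ u, (((𝓕 g u).re : ℝ) : ℂ) = 𝓕 g u := fun u ↦
    Complex.conj_eq_iff_re.mp (Real.conj_fourier_of_even (fun x ↦ b.neg x) u)
  -- The bump is even, so its transform is real; the square is therefore nonnegative and is the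
  -- transform of the self-convolution of `g`.
  let K : ℝ → ℝ := fun u ↦ (𝓕 g u).re ^ 2
  have hKI : Integrable K := by
    have := (Integrable.bdd_mul (c := ∫ x, ‖g x‖) hFI hFc.aestronglyMeasurable
      (Eventually.of_forall hFb)).re
    refine this.congr (Eventually.of_forall fun u ↦ ?_)
    simp only [K]
    rw [← hre u, ← Complex.ofReal_mul]
    simp [sq]
  have hKc : Continuous K := (Complex.continuous_re.comp hFc).pow 2
  have hK0 : ∀ u, 0 ≤ K u := fun u ↦ sq_nonneg _
  have hpos : 0 < ∫ u, K u := by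
    refine integral_pos_of_integrable_nonneg_nonzero (x := 0) hKc hKI hK0 ?_
    have h1 : 𝓕 g 0 = ((∫ x, b x : ℝ) : ℂ) := by
      rw [Real.fourier_real_eq, ← integral_complex_ofReal]
      simp [g]
    have h2 : 0 < ∫ x, b x := b.integral_pos
    simp only [K, h1, Complex.ofReal_re]
    positivity
  obtain ⟨k, hkc, hks, hk⟩ : ∃ k : ℝ → ℂ, Continuous k ∧ HasCompactSupport k ∧
      ∀ u, 𝓕 k u = K u := by
    refine ⟨convolution g g (ContinuousLinearMap.mul ℂ ℂ) volume,
      hgs.continuous_convolution_left _ hgd.continuous hgI.locallyIntegrable,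
      HasCompactSupport.convolution _ hgs hgs, fun u ↦ ?_⟩
    rw [Real.fourier_mul_convolution_eq hgI hgI u, ← hre u]
    simp [K, sq]
  clear_value K
  obtain ⟨c, hc⟩ : ∃ c : ℝ, ∫ u, K u = c := ⟨_, rfl⟩
  rw [hc] at hpos
  refine ⟨fun v ↦ (c⁻¹ : ℝ) • k v, fun u ↦ c⁻¹ * K u, by fun_prop, ?_, ?_,
    hKI.const_mul _, ?_, ?_⟩
  · exact hks.comp_left (g := fun z : ℂ ↦ (c⁻¹ : ℝ) • z) (smul_zero _)
  · intro u
    rw [Real.fourier_real_eq]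
    simp_rw [smul_comm _ (c⁻¹ : ℝ)]
    rw [integral_smul, ← Real.fourier_real_eq, hk u]
    simp
  · exact fun u ↦ mul_nonneg (inv_nonneg.mpr hpos.le) (hK0 u)
  · rw [integral_const_mul, hc, inv_mul_cancel₀ hpos.ne']

end FourierKernel

/-! ### From averages to pointwise limits -/

section SlowlyDecreasing

open MeasureTheory Topology Set

/-- The mass of a density escapes a large interval only by little. -/
theorem exists_one_sub_le_integral_Icc {K : ℝ → ℝ} (hK : Integrable K) (h1 : ∫ w, K w = 1)
    {ε : ℝ} (hε : 0 < ε) : ∃ A : ℝ, 0 < A ∧ 1 - ε ≤ ∫ w in Icc (-A) A, K w := by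
  have := (aecover_Icc (μ := volume) tendsto_neg_atTop_atBot
    (tendsto_id (α := ℝ) (x := atTop))).integral_tendsto_of_countably_generated hK
  rw [h1] at this
  obtain ⟨A, hA, hA0⟩ := ((this.eventually_const_le (show 1 - ε < 1 by linarith)).and
    (eventually_gt_atTop 0)).exists
  exact ⟨A, hA0, hA⟩

variable {F K : ℝ → ℝ} {C : ℝ}

theorem integrable_comp_add_div_mul_density (hm : Measurable F) (h0 : ∀ u, 0 ≤ F u)
    (hC : ∀ u, F u ≤ C) (hK : Integrable K) (l y : ℝ) :
    Integrable (fun w ↦ F (y + w / l) * K w) := by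
  refine hK.bdd_mul (c := C) (Measurable.aestronglyMeasurable (by fun_prop))
    (Eventually.of_forall fun w ↦ ?_)
  rw [Real.norm_eq_abs, abs_of_nonneg (h0 _)]
  exact hC _

/-- If the averages of a slowly decreasing bounded function against all the rescalings of a density
tend to one, then so does the function. -/
theorem tendsto_one_of_slowlyDecreasing (hm : Measurable F) (h0 : ∀ u, 0 ≤ F u)
    (hC : ∀ u, F u ≤ C) (hF : ∀ u v, 0 ≤ v → Real.exp (-v) * F u ≤ F (u + v))
    (hK : Integrable K) (hK0 : ∀ w, 0 ≤ K w) (h1 : ∫ w, K w = 1)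
    (hlim : ∀ l : ℝ, 0 < l → Tendsto (fun y ↦ ∫ w, F (y + w / l) * K w) atTop (𝓝 1)) :
    Tendsto F atTop (𝓝 1) := by
  have hC0 : 0 ≤ C := (h0 0).trans (hC 0)
  have hbounds : ∀ ε : ℝ, 0 < ε → ε < 1 → ∀ᶠ y in atTop,
      Real.exp (-ε) * (1 - ε - C * ε) ≤ F y ∧ F y ≤ Real.exp ε * (1 + ε) / (1 - ε) := by
    intro ε hε hε1
    obtain ⟨A, hA, hAε⟩ := exists_one_sub_le_integral_Icc hK h1 hε
    -- With this scale, `w / l` for `w ∈ [-A, A]` sweeps a window of total length `ε`.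
    set l : ℝ := 2 * A / ε with hl
    have hlpos : 0 < l := by positivity
    have hlA : 2 * (A / l) = ε := by rw [hl]; field_simp
    have hAl : 0 < A / l := by positivity
    have hw : ∀ w ∈ Icc (-A) A, -(A / l) ≤ w / l ∧ w / l ≤ A / l := fun w hw ↦
      ⟨by rw [← neg_div]; gcongr; exact hw.1, by gcongr; exact hw.2⟩
    -- Shifting the centre by `±A / l` puts the whole window on one side of `y`, so slow decrease
    -- compares `F y` with every value in it at the cost of a factor `exp ε`.
    have t1 : ∀ᶠ y in atTop, ∫ w, F (y + A / l + w / l) * K w < 1 + ε :=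
      (tendsto_atTop_add_const_right _ (A / l) tendsto_id).eventually
        ((hlim l hlpos).eventually_lt_const (by linarith))
    have t2 : ∀ᶠ y in atTop, 1 - ε < ∫ w, F (y + -(A / l) + w / l) * K w :=
      (tendsto_atTop_add_const_right _ (-(A / l)) tendsto_id).eventually
        ((hlim l hlpos).eventually_const_lt (by linarith))
    have hI := integrable_comp_add_div_mul_density hm h0 hC hK l
    filter_upwards [t1, t2] with y hy1 hy2
    constructor
    · have hub : ∫ w, F (y + -(A / l) + w / l) * K w ≤ Real.exp ε * F y + C * ε := by
        rw [← integral_add_compl (measurableSet_Icc (a := -A) (b := A)) (hI _)]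
        have hcompl : ∫ w in (Icc (-A) A)ᶜ, K w ≤ ε := by
          have := integral_add_compl (measurableSet_Icc (a := -A) (b := A)) hK
          linarith
        have hin : ∫ w in Icc (-A) A, K w ≤ 1 := by
          rw [← h1]
          exact setIntegral_le_integral hK (Eventually.of_forall hK0)
        gcongr
        · calc _ ≤ ∫ w in Icc (-A) A, Real.exp ε * F y * K w := by
                refine setIntegral_mono_on (hI _).integrableOn (hK.const_mul _).integrableOn
                  measurableSet_Icc fun w hwA ↦ mul_le_mul_of_nonneg_right ?_ (hK0 w)
                have := hF (y + -(A / l) + w / l) (A / l - w / l) (by linarith [(hw w hwA).2])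
                rw [show y + -(A / l) + w / l + (A / l - w / l) = y by ring, Real.exp_neg,
                  inv_mul_le_iff₀ (Real.exp_pos _)] at this
                refine this.trans (mul_le_mul_of_nonneg_right ?_ (h0 y))
                exact Real.exp_le_exp.mpr (by linarith [(hw w hwA).1])
            _ = Real.exp ε * F y * ∫ w in Icc (-A) A, K w := integral_const_mul _ _
            _ ≤ Real.exp ε * F y * 1 :=
                mul_le_mul_of_nonneg_left hin (mul_nonneg (Real.exp_nonneg _) (h0 y))
            _ = _ := mul_one _
        · calc _ ≤ ∫ w in (Icc (-A) A)ᶜ, C * K w :=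
                setIntegral_mono_on (hI _).integrableOn (hK.const_mul _).integrableOn
                  measurableSet_Icc.compl fun w _ ↦ mul_le_mul_of_nonneg_right (hC _) (hK0 w)
            _ = C * ∫ w in (Icc (-A) A)ᶜ, K w := integral_const_mul _ _
            _ ≤ C * ε := by gcongr
      rw [Real.exp_neg, inv_mul_le_iff₀ (Real.exp_pos _)]
      linarith
    · rw [le_div_iff₀ (by linarith)]
      have hlb : Real.exp (-ε) * F y * (1 - ε) ≤ ∫ w, F (y + A / l + w / l) * K w := by
        calc _ ≤ Real.exp (-ε) * F y * ∫ w in Icc (-A) A, K w :=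
              mul_le_mul_of_nonneg_left hAε (mul_nonneg (Real.exp_nonneg _) (h0 y))
          _ = ∫ w in Icc (-A) A, Real.exp (-ε) * F y * K w := (integral_const_mul _ _).symm
          _ ≤ ∫ w in Icc (-A) A, F (y + A / l + w / l) * K w := by
              refine setIntegral_mono_on (hK.const_mul _).integrableOn (hI _).integrableOn
                measurableSet_Icc fun w hwA ↦ mul_le_mul_of_nonneg_right ?_ (hK0 w)
              have := hF y (A / l + w / l) (by linarith [(hw w hwA).1])
              rw [← add_assoc] at this
              refine le_trans (mul_le_mul_of_nonneg_right ?_ (h0 y)) this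
              exact Real.exp_le_exp.mpr (by linarith [(hw w hwA).2])
          _ ≤ _ := setIntegral_le_integral (hI _)
              (Eventually.of_forall fun w ↦ mul_nonneg (h0 _) (hK0 w))
      rw [Real.exp_neg, mul_assoc, inv_mul_le_iff₀ (Real.exp_pos _)] at hlb
      exact hlb.trans (by gcongr)
  have hlo : Tendsto (fun ε : ℝ ↦ Real.exp (-ε) * (1 - ε - C * ε)) (𝓝[>] 0) (𝓝 1) := by
    have : Continuous fun ε : ℝ ↦ Real.exp (-ε) * (1 - ε - C * ε) := by fun_prop
    simpa using (this.tendsto 0).mono_left nhdsWithin_le_nhds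
  have hhi : Tendsto (fun ε : ℝ ↦ Real.exp ε * (1 + ε) / (1 - ε)) (𝓝[>] 0) (𝓝 1) := by
    have : ContinuousAt (fun ε : ℝ ↦ Real.exp ε * (1 + ε) / (1 - ε)) 0 :=
      ContinuousAt.div (by fun_prop) (by fun_prop) (by norm_num)
    simpa using this.tendsto.mono_left nhdsWithin_le_nhds
  have hsmall : ∀ᶠ ε : ℝ in 𝓝[>] 0, 0 < ε ∧ ε < 1 := Ioo_mem_nhdsGT one_pos
  refine tendsto_order.mpr ⟨fun a ha ↦ ?_, fun a ha ↦ ?_⟩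
  · obtain ⟨ε, hε, h⟩ := ((hlo.eventually_const_lt ha).and hsmall).exists
    filter_upwards [hbounds ε h.1 h.2] with y hy using hε.trans_le hy.1
  · obtain ⟨ε, hε, h⟩ := ((hhi.eventually_lt_const ha).and hsmall).exists
    filter_upwards [hbounds ε h.1 h.2] with y hy using hy.2.trans_lt hε

end SlowlyDecreasing

/-! ### The prime number theorem -/

section PrimeNumberTheorem

open MeasureTheory Topology FourierTransform Set

/-- The normalized Chebyshev function in the logarithmic variable. -/
noncomputable def normalizedPsi (u : ℝ) : ℝ := Chebyshev.psi (Real.exp u) * Real.exp (-u)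

theorem normalizedPsi_nonneg (u : ℝ) : 0 ≤ normalizedPsi u :=
  mul_nonneg (Chebyshev.psi_nonneg _) (Real.exp_nonneg _)

theorem normalizedPsi_le (u : ℝ) : normalizedPsi u ≤ Real.log 4 + 4 := by
  rw [normalizedPsi, Real.exp_neg, ← div_eq_mul_inv, div_le_iff₀ (Real.exp_pos u)]
  exact Chebyshev.psi_le_const_mul_self (Real.exp_nonneg u)

theorem measurable_normalizedPsi : Measurable normalizedPsi :=
  (Chebyshev.psi_mono.measurable.comp Real.measurable_exp).mul (by fun_prop)

theorem normalizedPsi_of_nonpos {u : ℝ} (hu : u ≤ 0) : normalizedPsi u = 0 := by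
  rw [normalizedPsi, Chebyshev.psi_eq_zero_of_le_one (Real.exp_le_one_iff.mpr hu), zero_mul]

/-- Monotonicity of `ψ`: only the factor `exp (-u)` can make the normalized function drop. -/
theorem exp_neg_mul_normalizedPsi_le (u v : ℝ) (hv : 0 ≤ v) :
    Real.exp (-v) * normalizedPsi u ≤ normalizedPsi (u + v) := by
  have h : Real.exp (-(u + v)) = Real.exp (-v) * Real.exp (-u) := by
    rw [← Real.exp_add]; ring_nf
  rw [normalizedPsi, normalizedPsi, h, mul_left_comm]
  gcongr
  linarith

theorem integrableOn_normalizedPsi_mul_cexp {z : ℂ} (hz : 0 < z.re) :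
    IntegrableOn (fun u : ℝ ↦ (normalizedPsi u : ℂ) * Complex.exp (-z * u)) (Ioi 0) := by
  have h1 : IntegrableOn (fun u : ℝ ↦ Complex.exp (-z * u)) (Ioi 0) :=
    integrableOn_exp_mul_complex_Ioi (by simpa using hz) 0
  refine Integrable.bdd_mul (c := Real.log 4 + 4) h1
    (Complex.measurable_ofReal.comp measurable_normalizedPsi).aestronglyMeasurable
    (Eventually.of_forall fun u ↦ ?_)
  rw [Complex.norm_real, Real.norm_eq_abs, abs_of_nonneg (normalizedPsi_nonneg u)]
  exact normalizedPsi_le u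

/-- Abel summation writes the Dirichlet series as an integral of `ψ`; substituting `x = exp u` makes
it a Laplace transform. -/
theorem LSeries_vonMangoldt_eq_mul_integral_normalizedPsi {z : ℂ} (hz : 0 < z.re) :
    LSeries (fun n ↦ (ArithmeticFunction.vonMangoldt n : ℂ)) (1 + z) =
      (1 + z) * ∫ u in Ioi (0 : ℝ), (normalizedPsi u : ℂ) * Complex.exp (-z * u) := by
  have hO : (fun n : ℕ ↦ ∑ k ∈ Finset.Icc 1 n, ArithmeticFunction.vonMangoldt k) =O[atTop]
      fun n ↦ (n : ℝ) ^ (1 : ℝ) := by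
    refine IsBigO.of_bound (Real.log 4 + 4) (Eventually.of_forall fun n ↦ ?_)
    have h1 := Chebyshev.psi_le_const_mul_self (Nat.cast_nonneg (α := ℝ) n)
    have h2 := Chebyshev.psi_nonneg (n : ℝ)
    rw [Chebyshev.psi, Nat.floor_natCast, ← Finset.Icc_add_one_left_eq_Ioc, zero_add] at h1 h2
    rw [Real.rpow_one, Real.norm_eq_abs, Real.norm_eq_abs, abs_of_nonneg h2, Nat.abs_cast]
    exact h1
  rw [LSeries_eq_mul_integral_of_nonneg _ zero_le_one (by simpa using hz) hO
    (fun n ↦ ArithmeticFunction.vonMangoldt_nonneg)]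
  congr 1
  have himg : Real.exp '' Ioi 0 = Ioi 1 := by
    ext x
    constructor
    · rintro ⟨u, hu, rfl⟩
      exact Real.one_lt_exp_iff.mpr hu
    · intro hx
      have hx : (1 : ℝ) < x := hx
      exact ⟨Real.log x, Real.log_pos hx, Real.exp_log (by linarith)⟩
  rw [← himg, integral_image_eq_integral_abs_deriv_smul measurableSet_Ioi
    (fun x _ ↦ (Real.hasDerivAt_exp x).hasDerivWithinAt) Real.exp_injective.injOn]
  refine setIntegral_congr_fun measurableSet_Ioi fun u _ ↦ ?_
  have hpsi : (∑ k ∈ Finset.Icc 1 ⌊Real.exp u⌋₊, (ArithmeticFunction.vonMangoldt k : ℂ)) =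
      (Chebyshev.psi (Real.exp u) : ℂ) := by
    rw [Chebyshev.psi, ← Finset.Icc_add_one_left_eq_Ioc, zero_add]
    push_cast
    rfl
  simp only [hpsi, normalizedPsi, Real.abs_exp, Complex.real_smul, Complex.ofReal_mul,
    Complex.ofReal_exp]
  rw [Complex.cpow_def_of_ne_zero (Complex.exp_ne_zero _), ← Complex.ofReal_exp,
    ← Complex.ofReal_log (Real.exp_nonneg u), Real.log_exp, Complex.ofReal_exp, mul_left_comm,
    mul_assoc, ← Complex.exp_add, ← Complex.exp_add]
  congr 2
  push_cast
  ring

/-- Modulo 1 the single residue class contains everything, so the auxiliary function is `-ζ'/ζ` with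
its pole at 1 removed. Its continuity on `1 ≤ re s` is where nonvanishing of `ζ` on that line
enters. -/
theorem LFunctionResidueClassAux_one_eq {s : ℂ} (hs : 1 < s.re) :
    ArithmeticFunction.vonMangoldt.LFunctionResidueClassAux (1 : ZMod 1) s =
      LSeries (fun n ↦ (ArithmeticFunction.vonMangoldt n : ℂ)) s - 1 / (s - 1) := by
  rw [ArithmeticFunction.vonMangoldt.eqOn_LFunctionResidueClassAux isUnit_one hs]
  have : ArithmeticFunction.vonMangoldt.residueClass (1 : ZMod 1) =
      fun n ↦ ArithmeticFunction.vonMangoldt n := by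
    ext n
    rw [ArithmeticFunction.vonMangoldt.residueClass, indicator_of_mem]
    exact Subsingleton.elim _ _
  simp [this]

/-- The error in the prime number theorem in the logarithmic variable. -/
noncomputable def psiError (u : ℝ) : ℝ := normalizedPsi u - (Ioi (0 : ℝ)).indicator 1 u

theorem measurable_psiError : Measurable psiError :=
  measurable_normalizedPsi.sub (measurable_one.indicator measurableSet_Ioi)

theorem psiError_of_nonpos {u : ℝ} (hu : u ≤ 0) : psiError u = 0 := by
  simp [psiError, normalizedPsi_of_nonpos hu, not_lt.mpr hu]

theorem abs_psiError_le (u : ℝ) : |psiError u| ≤ Real.log 4 + 4 := by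
  have h1 := normalizedPsi_nonneg u
  have h2 := normalizedPsi_le u
  have h3 : (0 : ℝ) ≤ (Ioi (0 : ℝ)).indicator 1 u :=
    indicator_nonneg (fun _ _ ↦ zero_le_one) u
  have h4 : (Ioi (0 : ℝ)).indicator (1 : ℝ → ℝ) u ≤ 1 :=
    indicator_le_self' (fun _ _ ↦ zero_le_one) u
  have h5 : 0 ≤ Real.log 4 := Real.log_nonneg (by norm_num)
  rw [psiError, abs_le]
  constructor <;> linarith

/-- With `A` the auxiliary function at `1 + z`, the transform is `(A + 1/z) / (1 + z) - 1/z`; the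
poles at `z = 0` cancel, leaving `(A - 1) / (1 + z)`. -/
theorem fourier_exp_mul_psiError {σ : ℝ} (hσ : 0 < σ) (v : ℝ) :
    𝓕 (fun u : ℝ ↦ (Real.exp (-σ * u) : ℂ) * (psiError u : ℂ)) v =
      (fun z : ℂ ↦ (ArithmeticFunction.vonMangoldt.LFunctionResidueClassAux (1 : ZMod 1) (1 + z)
        - 1) / (1 + z)) (σ + 2 * Real.pi * v * Complex.I) := by
  set z : ℂ := σ + 2 * Real.pi * v * Complex.I with hzdef
  have hz : 0 < z.re := by simpa [hzdef] using hσ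
  have hz0 : z ≠ 0 := fun h ↦ by simp [h] at hz
  have hz1 : 1 + z ≠ 0 := fun h ↦ by
    have := congrArg Complex.re h
    simp at this
    linarith
  have h1 : 𝓕 (fun u : ℝ ↦ (Real.exp (-σ * u) : ℂ) * (psiError u : ℂ)) v =
      ∫ u in Ioi (0 : ℝ), ((normalizedPsi u : ℂ) * Complex.exp (-z * u) -
        Complex.exp (-z * u)) := by
    rw [Real.fourier_real_eq_integral_exp_smul, ← integral_indicator measurableSet_Ioi]
    refine integral_congr_ae (Eventually.of_forall fun u ↦ ?_)
    simp only [smul_eq_mul]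
    rcases le_or_gt u 0 with hu | hu
    · simp [psiError_of_nonpos hu, not_lt.mpr hu]
    · rw [indicator_of_mem (by exact hu), psiError, indicator_of_mem (by exact hu),
        Complex.ofReal_exp, ← mul_assoc, ← Complex.exp_add]
      simp only [Pi.one_apply, Complex.ofReal_sub, Complex.ofReal_one]
      rw [mul_comm, sub_mul, one_mul]
      congr 3 <;> · rw [hzdef]; push_cast; ring
  rw [h1, integral_sub (integrableOn_normalizedPsi_mul_cexp hz)
    (integrableOn_exp_mul_complex_Ioi (by simpa using hz) 0),
    integral_exp_mul_complex_Ioi (by simpa using hz)]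
  simp only [LFunctionResidueClassAux_one_eq (s := 1 + z) (by simpa using hz),
    LSeries_vonMangoldt_eq_mul_integral_normalizedPsi hz]
  simp only [Complex.ofReal_zero, mul_zero, Complex.exp_zero, add_sub_cancel_left]
  field_simp
  ring

theorem tendsto_integral_psiError_mul {k : ℝ → ℂ} {K : ℝ → ℝ} (hk : Continuous k)
    (hks : HasCompactSupport k) (hkK : ∀ u, 𝓕 k u = K u) (hK : Integrable K) {l : ℝ}
    (hl : 0 < l) : Tendsto (fun y ↦ ∫ w, psiError (y + w / l) * K w) atTop (𝓝 0) := by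
  have hF : 𝓕 (fun v ↦ k (v / l)) = fun u ↦ ((l * K (l * u) : ℝ) : ℂ) := by
    ext u
    rw [Real.fourier_comp_div k hl, hkK]
    push_cast
    rfl
  have hG : ContinuousOn (fun z : ℂ ↦
      (ArithmeticFunction.vonMangoldt.LFunctionResidueClassAux (1 : ZMod 1) (1 + z) - 1) /
        (1 + z)) {s | 0 ≤ s.re} := by
    refine ContinuousOn.div (ContinuousOn.sub ?_ continuousOn_const) (by fun_prop) ?_
    · refine (ArithmeticFunction.vonMangoldt.continuousOn_LFunctionResidueClassAux
        (1 : ZMod 1)).comp (by fun_prop) fun z hz ↦ ?_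
      simpa using hz
    · intro z hz h
      have hz : 0 ≤ z.re := hz
      have := congrArg Complex.re h
      simp at this
      linarith
  have main := tendsto_integral_fourier_mul_atTop_zero (h := fun u ↦ (psiError u : ℂ))
    (C := Real.log 4 + 4) (Complex.measurable_ofReal.comp measurable_psiError)
    (fun u ↦ by simpa using abs_psiError_le u) (fun u hu ↦ by simp [psiError_of_nonpos hu]) hG
    (fun σ hσ v ↦ fourier_exp_mul_psiError hσ v) (k := fun v ↦ k (v / l))
    (by fun_prop) ?_ ?_
  · rw [← Complex.ofReal_zero] at main
    refine (Complex.continuous_re.continuousAt.tendsto.comp main).congr fun y ↦ ?_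
    simp only [Function.comp_apply, hF, ← Complex.ofReal_mul]
    rw [integral_complex_ofReal, Complex.ofReal_re]
    -- Together `e1` and `e2` perform the substitution `u = y + w / l`.
    have e1 := integral_add_left_eq_self (μ := (volume : Measure ℝ))
      (fun u ↦ l * K (l * (u - y)) * psiError u) y
    have e2 := Measure.integral_comp_div (fun u : ℝ ↦ K (l * u) * psiError (y + u)) l
    rw [abs_of_pos hl, smul_eq_mul, ← integral_const_mul] at e2
    rw [← e1]
    simp only [add_sub_cancel_left, mul_assoc]
    rw [← e2]
    refine integral_congr_ae (Eventually.of_forall fun w ↦ ?_)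
    simp only
    rw [mul_div_cancel₀ _ hl.ne', mul_comm]
  · have := hks.comp_homeomorph (Homeomorph.mulRight₀ l⁻¹ (inv_ne_zero hl.ne'))
    simpa [Function.comp_def, div_eq_mul_inv] using this
  · rw [hF]
    exact ((hK.comp_mul_left' hl.ne').const_mul l).ofReal

/-- The averages split into those of the error, which vanish, and those of the indicator of the
positive half-line, which tend to the total mass 1 of the kernel. -/
theorem tendsto_normalizedPsi : Tendsto normalizedPsi atTop (𝓝 1) := by
  obtain ⟨k, K, hk, hks, hkK, hK, hK0, h1⟩ := exists_fourier_eq_density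
  refine tendsto_one_of_slowlyDecreasing measurable_normalizedPsi normalizedPsi_nonneg
    normalizedPsi_le exp_neg_mul_normalizedPsi_le hK hK0 h1 fun l hl ↦ ?_
  have t1 := tendsto_integral_psiError_mul hk hks hkK hK hl
  have hind : ∀ u : ℝ, ‖(Ioi (0 : ℝ)).indicator (1 : ℝ → ℝ) u‖ ≤ 1 := fun u ↦
    (norm_indicator_le_norm_self _ u).trans (by simp)
  have hmeas : Measurable ((Ioi (0 : ℝ)).indicator (1 : ℝ → ℝ)) :=
    measurable_one.indicator measurableSet_Ioi
  have t2 : Tendsto (fun y : ℝ ↦ ∫ w, (Ioi (0 : ℝ)).indicator 1 (y + w / l) * K w) atTop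
      (𝓝 1) := by
    rw [← h1]
    refine tendsto_integral_filter_of_dominated_convergence K ?_ ?_ hK ?_
    · refine Eventually.of_forall fun y ↦ ?_
      exact (Measurable.aestronglyMeasurable (by fun_prop)).mul hK.aestronglyMeasurable
    · refine Eventually.of_forall fun y ↦ Eventually.of_forall fun w ↦ ?_
      rw [norm_mul, Real.norm_of_nonneg (hK0 w)]
      exact mul_le_of_le_one_left (hK0 w) (hind _)
    · refine Eventually.of_forall fun w ↦ tendsto_const_nhds.congr' ?_
      filter_upwards [eventually_gt_atTop (-(w / l))] with y hy
      rw [indicator_of_mem (show y + w / l ∈ Ioi 0 by rw [mem_Ioi]; linarith), Pi.one_apply,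
        one_mul]
  rw [← zero_add (1 : ℝ)]
  refine (t1.add t2).congr fun y ↦ ?_
  rw [← integral_add]
  · refine integral_congr_ae (Eventually.of_forall fun w ↦ ?_)
    simp only [psiError]
    ring
  · exact hK.bdd_mul (c := Real.log 4 + 4)
      (measurable_psiError.comp (by fun_prop)).aestronglyMeasurable
      (Eventually.of_forall fun w ↦ abs_psiError_le _)
  · exact hK.bdd_mul (c := 1) (hmeas.comp (by fun_prop)).aestronglyMeasurable
      (Eventually.of_forall fun w ↦ hind _)

/-- The prime number theorem for the second Chebyshev function. -/
theorem psi_isEquivalent_id : Chebyshev.psi ~[atTop] (fun x ↦ x) := by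
  rw [isEquivalent_iff_tendsto_one (eventually_ne_atTop 0)]
  refine (tendsto_normalizedPsi.comp Real.tendsto_log_atTop).congr' ?_
  filter_upwards [eventually_gt_atTop 0] with x hx
  simp [normalizedPsi, Real.exp_neg, Real.exp_log hx, div_eq_mul_inv]

/-- The prime number theorem for the first Chebyshev function. -/
theorem theta_isEquivalent_id : Chebyshev.theta ~[atTop] (fun x ↦ x) := by
  have h : (fun x ↦ Chebyshev.psi x - Chebyshev.theta x) =o[atTop] fun x : ℝ ↦ x := by
    refine Chebyshev.isBigO_psi_sub_theta_sqrt.trans_isLittleO ?_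
    refine (isLittleO_iff_tendsto' ?_).mpr ?_
    · filter_upwards [eventually_gt_atTop 0] with x hx h using absurd h hx.ne'
    · refine (tendsto_inv_atTop_zero.comp Real.tendsto_sqrt_atTop).congr fun x ↦ ?_
      rw [Real.sqrt_div_self', one_div, Function.comp_apply]
  refine (psi_isEquivalent_id.sub_isLittleO h).congr_left ?_
  exact Eventually.of_forall fun x ↦ by simp

/-- The prime number theorem. -/
theorem primeCounting_floor_isEquivalent :
    (fun x : ℝ ↦ (Nat.primeCounting ⌊x⌋₊ : ℝ)) ~[atTop] (fun x ↦ x / Real.log x) := by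
  have h1 : (fun x ↦ Chebyshev.theta x / Real.log x) ~[atTop] (fun x ↦ x / Real.log x) :=
    theta_isEquivalent_id.div IsEquivalent.refl
  have h2 : (fun x : ℝ ↦ x / Real.log x ^ 2) =o[atTop] fun x : ℝ ↦ x / Real.log x := by
    rw [isLittleO_iff_tendsto' ?_]
    · refine Real.tendsto_log_atTop.inv_tendsto_atTop.congr' ?_
      filter_upwards [eventually_gt_atTop 1] with x hx
      have := Real.log_pos hx
      simp only [Pi.inv_apply]
      field_simp
    · filter_upwards [eventually_gt_atTop 1] with x hx h
      have := Real.log_pos hx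
      have : 0 < x / Real.log x := by positivity
      linarith
  refine (h1.add_isLittleO (Chebyshev.primeCounting_sub_theta_div_log_isBigO.trans_isLittleO
    h2)).congr_left ?_
  exact Eventually.of_forall fun x ↦ by simp

end PrimeNumberTheorem

/-! ### The Sidon property and the count -/

section LogPrimeSet

open Topology

/-- Distinct integers differ by at least 1; apply `1 - 1/t ≤ log t` to `t = c * d / (a * b)`. -/
theorem Real.inv_mul_le_log_mul_sub_log_mul {a b c d : ℕ} (ha : 0 < a) (hb : 0 < b)
    (h : a * b < c * d) :
    ((c : ℝ) * d)⁻¹ ≤ (Real.log c + Real.log d) - (Real.log a + Real.log b) := by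
  have hcd : 0 < c * d := by omega
  have hc : (0 : ℝ) < c := by exact_mod_cast Nat.pos_of_mul_pos_right hcd
  have hd : (0 : ℝ) < d := by exact_mod_cast Nat.pos_of_mul_pos_left hcd
  have ha : (0 : ℝ) < a := by exact_mod_cast ha
  have hb : (0 : ℝ) < b := by exact_mod_cast hb
  have h : (a : ℝ) * b + 1 ≤ c * d := by exact_mod_cast h
  rw [← Real.log_mul hc.ne' hd.ne', ← Real.log_mul ha.ne' hb.ne', ← Real.log_div (by positivity)
    (by positivity)]
  refine le_trans ?_ (Real.one_sub_inv_le_log_of_pos (by positivity))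
  rw [inv_div, inv_eq_one_div, le_sub_iff_add_le, ← add_div, div_le_one (by positivity)]
  linarith

theorem floor_log_add_floor_log_lt {n : ℕ} (hn : 1 < n) {a b c d : ℕ} (ha : 0 < a) (hb : 0 < b)
    (hc : (c : ℝ) ≤ √((n : ℝ) / (2 * Real.log n))) (hd : (d : ℝ) ≤ √((n : ℝ) / (2 * Real.log n)))
    (h : a * b < c * d) :
    ⌊2 * (n : ℝ) / Real.log n * Real.log a⌋₊ + ⌊2 * (n : ℝ) / Real.log n * Real.log b⌋₊ <
      ⌊2 * (n : ℝ) / Real.log n * Real.log c⌋₊ + ⌊2 * (n : ℝ) / Real.log n * Real.log d⌋₊ := by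
  have hn1 : (1 : ℝ) < n := by exact_mod_cast hn
  have hn0 : (0 : ℝ) < n := by linarith
  have hlog : 0 < Real.log n := Real.log_pos hn1
  have hcd : (0 : ℝ) < c * d := by
    have : 0 < c * d := by omega
    exact_mod_cast this
  have hcdle : (c : ℝ) * d ≤ n / (2 * Real.log n) := by
    rw [← Real.mul_self_sqrt (show 0 ≤ (n : ℝ) / (2 * Real.log n) by positivity)]
    gcongr
  have hgap := Real.inv_mul_le_log_mul_sub_log_mul ha hb h
  set α : ℝ := 2 * (n : ℝ) / Real.log n with hα
  have hα0 : 0 < α := by positivity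
  have h4 : 4 ≤ α * ((Real.log c + Real.log d) - (Real.log a + Real.log b)) := by
    calc (4 : ℝ) = α * ((n : ℝ) / (2 * Real.log n))⁻¹ := by rw [hα]; field_simp; norm_num
      _ ≤ α * ((c : ℝ) * d)⁻¹ := by gcongr
      _ ≤ _ := by gcongr
  -- Floors on the smaller side can only help, and the two on the larger side lose less than 1 each,
  -- so the gap of 4 is ample.
  have fa := Nat.floor_le (mul_nonneg hα0.le (Real.log_natCast_nonneg a))
  have fb := Nat.floor_le (mul_nonneg hα0.le (Real.log_natCast_nonneg b))
  have fc := Nat.sub_one_lt_floor (α * Real.log c)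
  have fd := Nat.sub_one_lt_floor (α * Real.log d)
  have : ((⌊α * Real.log a⌋₊ + ⌊α * Real.log b⌋₊ : ℕ) : ℝ) <
      ((⌊α * Real.log c⌋₊ + ⌊α * Real.log d⌋₊ : ℕ) : ℝ) := by
    push_cast
    linarith
  exact_mod_cast this

theorem mul_eq_mul_of_floor_log_add_floor_log_eq {n : ℕ} (hn : 1 < n) {a b c d : ℕ}
    (ha : 0 < a) (hb : 0 < b) (hc : 0 < c) (hd : 0 < d)
    (ha' : (a : ℝ) ≤ √((n : ℝ) / (2 * Real.log n))) (hb' : (b : ℝ) ≤ √((n : ℝ) / (2 * Real.log n)))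
    (hc' : (c : ℝ) ≤ √((n : ℝ) / (2 * Real.log n))) (hd' : (d : ℝ) ≤ √((n : ℝ) / (2 * Real.log n)))
    (h : ⌊2 * (n : ℝ) / Real.log n * Real.log a⌋₊ + ⌊2 * (n : ℝ) / Real.log n * Real.log b⌋₊ =
      ⌊2 * (n : ℝ) / Real.log n * Real.log c⌋₊ + ⌊2 * (n : ℝ) / Real.log n * Real.log d⌋₊) :
    a * b = c * d := by
  rcases lt_trichotomy (a * b) (c * d) with hlt | heq | hlt
  · exact absurd h (floor_log_add_floor_log_lt hn ha hb hc' hd' hlt).ne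
  · exact heq
  · exact absurd h (floor_log_add_floor_log_lt hn hc hd ha' hb' hlt).ne'

theorem Nat.Prime.eq_and_eq_or_eq_and_eq_of_mul_eq_mul {p q r s : ℕ} (hp : p.Prime)
    (hr : r.Prime) (hs : s.Prime) (h : p * q = r * s) :
    (p = r ∧ q = s) ∨ (p = s ∧ q = r) := by
  rcases (Nat.Prime.dvd_mul hp).mp ⟨q, h.symm⟩ with hpr | hps
  · obtain rfl := (Nat.prime_dvd_prime_iff_eq hp hr).mp hpr
    exact .inl ⟨rfl, Nat.eq_of_mul_eq_mul_left hp.pos h⟩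
  · obtain rfl := (Nat.prime_dvd_prime_iff_eq hp hs).mp hps
    exact .inr ⟨rfl, Nat.eq_of_mul_eq_mul_left hp.pos (h.trans (mul_comm _ _))⟩

theorem isSidon_logPrimeSet {n : ℕ} (hn : 1 < n) : IsSidon (logPrimeSet n) := by
  rintro _ ⟨p, hp, hp', rfl⟩ _ ⟨q, hq, hq', rfl⟩ _ ⟨r, hr, hr', rfl⟩ _ ⟨s, hs, hs', rfl⟩ h
  have := mul_eq_mul_of_floor_log_add_floor_log_eq hn hp.pos hq.pos hr.pos hs.pos hp' hq' hr' hs' h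
  rcases hp.eq_and_eq_or_eq_and_eq_of_mul_eq_mul hr hs this with ⟨rfl, rfl⟩ | ⟨rfl, rfl⟩
  · exact .inl ⟨rfl, rfl⟩
  · exact .inr ⟨rfl, rfl⟩

theorem logPrimeSet_eq_image (n : ℕ) :
    logPrimeSet n = (fun p : ℕ ↦ ⌊2 * (n : ℝ) / Real.log n * Real.log p⌋₊) ''
      (Nat.primesLE ⌊√((n : ℝ) / (2 * Real.log n))⌋₊ : Set ℕ) := by
  ext x
  simp only [logPrimeSet, Set.mem_ofPred_eq, Set.mem_image, Finset.mem_coe, Nat.mem_primesLE,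
    Nat.le_floor_iff (Real.sqrt_nonneg _)]
  constructor
  · rintro ⟨p, hp, hp', rfl⟩
    exact ⟨p, ⟨hp', hp⟩, rfl⟩
  · rintro ⟨p, ⟨hp', hp⟩, rfl⟩
    exact ⟨p, hp, hp', rfl⟩

theorem finite_logPrimeSet (n : ℕ) : (logPrimeSet n).Finite := by
  rw [logPrimeSet_eq_image]
  exact (Finset.finite_toSet _).image _

theorem ncard_logPrimeSet {n : ℕ} (hn : 1 < n) :
    (logPrimeSet n).ncard = Nat.primeCounting ⌊√((n : ℝ) / (2 * Real.log n))⌋₊ := by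
  rw [logPrimeSet_eq_image, Set.InjOn.ncard_image, Set.ncard_coe_finset,
    Nat.primesLE_card_eq_primeCounting]
  intro p hp q hq h
  simp only [Finset.mem_coe, Nat.mem_primesLE, Nat.le_floor_iff (Real.sqrt_nonneg _)] at hp hq
  -- Injectivity comes from doubling the equality of floors: it yields `p * p = q * q`.
  have := mul_eq_mul_of_floor_log_add_floor_log_eq hn hp.2.pos hp.2.pos hq.2.pos hq.2.pos
    hp.1 hp.1 hq.1 hq.1 (congrArg₂ (· + ·) h h)
  exact Nat.mul_self_inj.mp this

theorem tendsto_div_two_mul_log_atTop :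
    Tendsto (fun x : ℝ ↦ x / (2 * Real.log x)) atTop atTop := by
  have h : Tendsto (fun x : ℝ ↦ Real.log x / x) atTop (𝓝[>] 0) := by
    refine tendsto_nhdsWithin_iff.mpr ⟨Real.isLittleO_log_id_atTop.tendsto_div_nhds_zero, ?_⟩
    filter_upwards [eventually_gt_atTop 1] with x hx
    exact div_pos (Real.log_pos hx) (by linarith)
  refine (h.inv_tendsto_nhdsGT_zero.const_mul_atTop (show (0 : ℝ) < 1 / 2 by norm_num)).congr
    fun x ↦ ?_
  rw [Pi.inv_apply, inv_div, div_mul_div_comm, one_mul]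

theorem log_sqrt_div_two_mul_log_isEquivalent :
    (fun x : ℝ ↦ Real.log √(x / (2 * Real.log x))) ~[atTop] (fun x ↦ Real.log x / 2) := by
  have h : (fun x : ℝ ↦ Real.log (2 * Real.log x) / 2) =o[atTop] fun x ↦ Real.log x / 2 := by
    have h1 : (fun y : ℝ ↦ Real.log (2 * y)) =o[atTop] fun y ↦ y := by
      have := Real.isLittleO_log_id_atTop.comp_tendsto
        (tendsto_id.const_mul_atTop (show (0 : ℝ) < 2 by norm_num))
      exact this.trans_isBigO (isBigO_const_mul_self 2 (fun y : ℝ ↦ y) atTop)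
    simpa [div_eq_inv_mul, Function.comp_def] using!
      ((h1.comp_tendsto Real.tendsto_log_atTop).const_mul_left (1 / 2)).trans_isBigO
        (isBigO_self_const_mul (show (2⁻¹ : ℝ) ≠ 0 by norm_num) Real.log atTop)
  refine (IsEquivalent.refl.sub_isLittleO h).congr_left ?_
  filter_upwards [eventually_gt_atTop 1] with x hx
  have := Real.log_pos hx
  rw [Real.log_sqrt (by positivity), Real.log_div (by positivity) (by positivity), sub_div]
  rfl

theorem sqrt_div_two_mul_log_div_eq {x : ℝ} (hx : 1 < x) :
    √(x / (2 * Real.log x)) / (Real.log x / 2) = √(2 * x) / Real.log x ^ (3 / 2 : ℝ) := by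
  have hl := Real.log_pos hx
  have hpow : Real.log x ^ (3 / 2 : ℝ) = Real.log x * √(Real.log x) := by
    rw [show (3 / 2 : ℝ) = 1 + 1 / 2 by norm_num, Real.rpow_add hl, Real.rpow_one,
      Real.sqrt_eq_rpow]
  -- Writing the denominator with `2 ^ 2` lets the root release a factor 2, which cancels the 2 in
  -- `log x / 2`.
  have h : x / (2 * Real.log x) = 2 * x / (2 ^ 2 * Real.log x) := by field_simp
  rw [hpow, h, Real.sqrt_div (by linarith), Real.sqrt_mul (by norm_num) (Real.log x),
    Real.sqrt_sq (by norm_num)]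
  field_simp

end LogPrimeSet

theorem theorem2p1 :
    (∀ᶠ n : ℕ in atTop, (logPrimeSet n).Finite ∧ IsSidon (logPrimeSet n)) ∧
    (fun n : ℕ => ((logPrimeSet n).ncard : ℝ)) ~[atTop]
      (fun n : ℕ => √(2 * (n : ℝ)) / (Real.log n) ^ (3 / 2 : ℝ)) := by
  constructor
  · filter_upwards [eventually_gt_atTop 1] with n hn
    exact ⟨finite_logPrimeSet n, isSidon_logPrimeSet hn⟩
  · have h1 := (primeCounting_floor_isEquivalent.comp_tendsto
      (Real.tendsto_sqrt_atTop.comp tendsto_div_two_mul_log_atTop)).trans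
        (IsEquivalent.refl.div log_sqrt_div_two_mul_log_isEquivalent)
    refine ((h1.comp_tendsto tendsto_natCast_atTop_atTop).congr_left ?_).congr_right ?_
    · filter_upwards [eventually_gt_atTop 1] with n hn
      simp [ncard_logPrimeSet hn]
    · filter_upwards [eventually_gt_atTop 1] with n hn
      exact sqrt_div_two_mul_log_div_eq (by exact_mod_cast hn)
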